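/- All measures on $\mathbb{R}$ and $\mathbb{R}^2$ are Borel measures, and $(X,Y)$ denotes the identity on $\mathbb{R}^2$. \textbf{Definitions.} Let $\mathfrak{M}^1$ be the set of finite measures on $\mathbb{R}$ with finite first moment. For $\mu,\nu\in\mathfrak{M}^1$ write $\mu\le_{cd}\nu$ if $\int\phi\,d\mu\le\int\phi\,d\nu$ (in $(-\infty,\infty]$) for all convex, nonincreasing $\phi:\mathbb{R}\to\mathbb{R}$. The \emph{shadow} $S^\nu(\mu)$ of $\mu$ in $\nu$ is the least element, for $\le_{cd}$, of the set $\{\theta\in\mathfrak{M}^1:\ \mu\le_{cd}\theta\le\nu\}$. For probability measures $\mu,\nu\in\mathfrak{M}^1$, let $\mathcal{S}(\mu,\nu)$ be the set of all measures $P$ on $\mathbb{R}^2$ with first marginal $\mu$ and second marginal $\nu$ that are supermartingales, i.e. $\int Y\mathbf 1_A(X)\,dP\le\int X\mathbf 1_A(X)\,dP$ for all Borel $A\subseteq\mathbb{R}$; a measure for which equality holds for all such $A$ is called a martingale. The \emph{Increasing Supermartingale Transport} $\overrightarrow{P}$ of $(\mu,\nu)$ is the unique measure on $\mathbb{R}^2$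 with first marginal $\mu$ that transports $\mu|_{(-\infty,x]}$ to its shadow $S^\nu(\mu|_{(-\infty,x]})$ for every $x\in\mathbb{R}$, i.e. $\overrightarrow{P}((-\infty,x]\times A)=S^\nu(\mu|_{(-\infty,x]})(A)$ for all Borel $A$. The \emph{Decreasing Supermartingale Transport} $\overleftarrow{P}$ is the unique measure on $\mathbb{R}^2$ with first marginal $\mu$ that transports $\mu|_{[x,\infty)}$ to its shadow $S^\nu(\mu|_{[x,\infty)})$ for every $x\in\mathbb{R}$. Let $\Gamma\subseteq\mathbb{R}^2$ and $M\subseteq\mathbb{R}$. The pair $(\Gamma,M)$ is \emph{nondegenerate} if (a) whenever $(x,y)\in\Gamma$ with $y>x$, there is $y'<x$ with $(x,y')\in\Gamma$; and (b) whenever $x\in M$ and $(x,y)\in\Gamma$ with $y<x$, there is $y'>x$ with $(x,y')\in\Gamma$. It is \emph{first-order left-monotone} (resp. \emph{first-order right-monotone}) if for all $(x_1,y_1),(x_2,y_2)\in\Gamma$ with $x_1<x_2$ one has $y_1\le y_2$ whenever $x_2\notin M$ (resp. $y_2\le y_1$ whenever $x_1\notin M$). It is \emph{second-order left-monotone} (resp.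 \emph{second-order right-monotone}) if for all $(x,y_1),(x,y_2),(x',y')\in\Gamma$ with $y_1<y_2$ one has $y'\notin(y_1,y_2)$ whenever $x<x'$ (resp. $x'<x$). \textbf{Theorem.} Let $\mu,\nu$ be probability measures on $\mathbb{R}$ with finite first moment, let $\Gamma\subseteq\mathbb{R}^2$ and $M\subseteq\mathbb{R}$ be Borel sets such that $(\Gamma,M)$ is nondegenerate, and let $P\in\mathcal{S}(\mu,\nu)$ be concentrated on $\Gamma$ (that is, $P(\Gamma)=1$) and such that the restriction $P|_{M\times\mathbb{R}}$ is a martingale. (i) If $(\Gamma,M)$ is first-order right-monotone and second-order left-monotone, then $P$ is the Increasing Supermartingale Transport: $P$ has the property defining $\overrightarrow{P}$, and it is the only measure on $\mathbb{R}^2$ with this property. (ii) If $(\Gamma,M)$ is first-order left-monotone and second-order right-monotone, then $P$ is the Decreasing Supermartingale Transport: $P$ has the property defining $\overleftarrow{P}$, and it is the only measure on $\mathbb{R}^2$ with this property. -/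

import Mathlib

open MeasureTheory Set

namespace SupermartingaleTransport

/-- Finite Borel measures on `ℝ` with a finite first moment. -/
structure HasFirstMoment (μ : Measure ℝ) : Prop where
  finite : IsFiniteMeasure μ
  integrable : Integrable (fun x : ℝ => x) μ

/-- Convex-decreasing order: `μ(φ) ≤ ν(φ)` for every convex nonincreasing `φ : ℝ → ℝ`.
For measures with a finite first moment the negative part of such a `φ` is always integrable,
so `μ(φ)` and `ν(φ)` are well defined in `(-∞, ∞]` and are finite exactly if `φ` is integrable;
the inequality in `(-∞, ∞]` says that `μ(φ)` is finite and at most `ν(φ)` whenever `ν(φ)` is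
finite. -/
structure ConvexDecreasingLE (μ ν : Measure ℝ) : Prop where
  left : HasFirstMoment μ
  right : HasFirstMoment ν
  le : ∀ φ : ℝ → ℝ, ConvexOn ℝ univ φ → Antitone φ → Integrable φ ν →
    Integrable φ μ ∧ ∫ x, φ x ∂μ ≤ ∫ x, φ x ∂ν

/-- The set of all measures `θ` with a finite first moment such that `μ ≤_cd θ ≤ ν`. -/
def between (μ ν : Measure ℝ) : Set (Measure ℝ) :=
  {θ | ConvexDecreasingLE μ θ ∧ θ ≤ ν}

/-- `θ` is the shadow of `μ` in `ν`: the least element of `between μ ν` for the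
convex-decreasing order. -/
structure IsShadow (μ ν θ : Measure ℝ) : Prop where
  mem : θ ∈ between μ ν
  least : ∀ η ∈ between μ ν, ConvexDecreasingLE θ η

/-- The coordinates `(X, Y)` form a supermartingale under `P`: `E[Y 1_A(X)] ≤ E[X 1_A(X)]` for
all Borel sets `A`. -/
structure IsSupermartingale (P : Measure (ℝ × ℝ)) : Prop where
  integrable_fst : Integrable (fun p : ℝ × ℝ => p.1) P
  integrable_snd : Integrable (fun p : ℝ × ℝ => p.2) P
  setIntegral_le : ∀ A : Set ℝ, MeasurableSet A →
    ∫ p in Prod.fst ⁻¹' A, p.2 ∂P ≤ ∫ p in Prod.fst ⁻¹' A, p.1 ∂P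

/-- The coordinates `(X, Y)` form a martingale under `P`: `E[Y 1_A(X)] = E[X 1_A(X)]` for all
Borel sets `A`. -/
structure IsMartingale (P : Measure (ℝ × ℝ)) : Prop where
  integrable_fst : Integrable (fun p : ℝ × ℝ => p.1) P
  integrable_snd : Integrable (fun p : ℝ × ℝ => p.2) P
  setIntegral_eq : ∀ A : Set ℝ, MeasurableSet A →
    ∫ p in Prod.fst ⁻¹' A, p.2 ∂P = ∫ p in Prod.fst ⁻¹' A, p.1 ∂P

/-- The set of all couplings of `μ` and `ν` that are supermartingales. -/
def supermartingaleCouplings (μ ν : Measure ℝ) : Set (Measure (ℝ × ℝ)) :=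
  {P | P.fst = μ ∧ P.snd = ν ∧ IsSupermartingale P}

/-- Defining property of the Increasing Supermartingale Transport: the first marginal is `μ` and,
for all `x`, the restriction of `μ` to `(-∞, x]` is transported to its shadow in `ν`. -/
structure IsIncreasingSupermartingaleTransport (μ ν : Measure ℝ) (P : Measure (ℝ × ℝ)) :
    Prop where
  fst_eq : P.fst = μ
  shadow : ∀ x : ℝ,
    IsShadow (μ.restrict (Iic x)) ν (P.restrict (Iic x ×ˢ (univ : Set ℝ))).snd

/-- Defining property of the Decreasing Supermartingale Transport: the first marginal is `μ` and,
for all `x`, the restriction of `μ` to `[x, ∞)` is transported to its shadow in `ν`. -/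
structure IsDecreasingSupermartingaleTransport (μ ν : Measure ℝ) (P : Measure (ℝ × ℝ)) :
    Prop where
  fst_eq : P.fst = μ
  shadow : ∀ x : ℝ,
    IsShadow (μ.restrict (Ici x)) ν (P.restrict (Ici x ×ˢ (univ : Set ℝ))).snd

def FirstOrderLeftMonotone (Γ : Set (ℝ × ℝ)) (M : Set ℝ) : Prop :=
  ∀ x₁ y₁ x₂ y₂ : ℝ, (x₁, y₁) ∈ Γ → (x₂, y₂) ∈ Γ → x₁ < x₂ → x₂ ∉ M → y₁ ≤ y₂

def FirstOrderRightMonotone (Γ : Set (ℝ × ℝ)) (M : Set ℝ) : Prop :=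
  ∀ x₁ y₁ x₂ y₂ : ℝ, (x₁, y₁) ∈ Γ → (x₂, y₂) ∈ Γ → x₁ < x₂ → x₁ ∉ M → y₂ ≤ y₁

def SecondOrderLeftMonotone (Γ : Set (ℝ × ℝ)) : Prop :=
  ∀ x y₁ y₂ x' y' : ℝ, (x, y₁) ∈ Γ → (x, y₂) ∈ Γ → (x', y') ∈ Γ → y₁ < y₂ → x < x' →
    y' ∉ Ioo y₁ y₂

def SecondOrderRightMonotone (Γ : Set (ℝ × ℝ)) : Prop :=
  ∀ x y₁ y₂ x' y' : ℝ, (x, y₁) ∈ Γ → (x, y₂) ∈ Γ → (x', y') ∈ Γ → y₁ < y₂ → x' < x →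
    y' ∉ Ioo y₁ y₂

structure Nondegenerate (Γ : Set (ℝ × ℝ)) (M : Set ℝ) : Prop where
  exists_lt : ∀ x y : ℝ, (x, y) ∈ Γ → x < y → ∃ y' < x, (x, y') ∈ Γ
  exists_gt : ∀ x y : ℝ, x ∈ M → (x, y) ∈ Γ → y < x → ∃ y' > x, (x, y') ∈ Γ

end SupermartingaleTransport

/-!
Put values `∫ (k - y)⁺ dμ` carry the whole argument. Together with the total mass they generate the
convex-decreasing order (`convexDecreasingLE_of_put`: every convex nonincreasing function is, to the
left of any level, a mixture of puts) and they determine the measure (`eq_of_put_eq`); so shadows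
are unique, and a coupling is determined by the images of the restrictions of its first marginal to
half-lines. It remains to see that `P` transports the restriction of `μ` to a half-line `J` to its
shadow (`isShadow_of_separated`). Write `Γ_x = {y | (x, y) ∈ Γ}` for the fibre over `x`.

Let `θ` be the image of `μ|_J` under `P` and let `μ|_J ≤_cd η ≤ ν`. Let `V` be the open set of all
`z` that lie strictly between two points of a fibre `Γ_x` with `x ∈ J`, or strictly above a point of
a fibre `Γ_x` with `x ∈ J \ M`. Second- and first-order monotonicity say that no mass starting
outside `J` reaches `V`; hence `θ = ν ≥ η` on `V`.

* If `k ∉ V`, the fibres over `J \ M` lie above `k` and contribute nothing to the put with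
  strike `k`. No fibre over `J ∩ M` crosses `k`, and nondegeneracy puts its starting point on
  the same side of `k`; since `P` is a martingale over `M`, the put value of `θ` is at most that of
  `μ|_J`, which is at most that of `η` (`put_snd_le_put_fst`).
* On a component of `V`, `θ ≥ η` makes the difference of the put values of `θ` and `η` convex, and
  nonincreasing if the component is unbounded above. As the difference vanishes at `-∞`, the
  inequality extends from the complement of `V` to `V` (`put_le_of_restrict_le`).
-/

namespace SupermartingaleTransport

open Filter Topology

/-! ### Put payoffs and the convex-decreasing order -/

theorem volume_inter_Ioi_of_isLowerSet {S : Set ℝ} (hS : IsLowerSet S) (hne : S.Nonempty)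
    (hb : BddAbove S) (y : ℝ) :
    volume (S ∩ Ioi y) = ENNReal.ofReal (max (sSup S - y) 0) := by
  have h1 : Ioo y (sSup S) ⊆ S ∩ Ioi y := fun t ht => by
    obtain ⟨s, hs, hts⟩ := exists_lt_of_lt_csSup hne ht.2
    exact ⟨hS hts.le hs, ht.1⟩
  have h2 : S ∩ Ioi y ⊆ Ioc y (sSup S) := fun t ht => ⟨ht.2, le_csSup hb ht.1⟩
  have h3 : ENNReal.ofReal (max (sSup S - y) 0) = ENNReal.ofReal (sSup S - y) := by
    rcases le_total (sSup S - y) 0 with h | h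
    · simp [max_eq_right h, ENNReal.ofReal_of_nonpos h]
    · rw [max_eq_left h]
  rw [h3]
  apply le_antisymm
  · simpa using measure_mono (μ := volume) h2
  · simpa using measure_mono (μ := volume) h1

theorem HasFirstMoment.integrable_put {μ : Measure ℝ} (hμ : HasFirstMoment μ) (k : ℝ) :
    Integrable (fun y => max (k - y) 0) μ := by
  have := hμ.finite
  exact ((integrable_const k).sub hμ.integrable).sup (integrable_const 0)

theorem convexOn_put (k : ℝ) : ConvexOn ℝ univ (fun y : ℝ => max (k - y) 0) := by
  have h1 : ConvexOn ℝ univ (fun y : ℝ => k - y) :=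
    (convexOn_const k convex_univ).sub (concaveOn_id convex_univ)
  exact h1.sup (convexOn_const 0 convex_univ)

theorem antitone_put (k : ℝ) : Antitone (fun y : ℝ => max (k - y) 0) := fun x y h =>
  max_le_max (by linarith) le_rfl

/-- As a function of `y`, the length of `S ∩ (y, ∞)` is a put payoff with strike `sSup S`. -/
theorem lintegral_volume_inter_Ioi_le {μ ν : Measure ℝ} (hμ : HasFirstMoment μ)
    (hν : HasFirstMoment ν)
    (hput : ∀ k : ℝ, ∫ y, max (k - y) 0 ∂μ ≤ ∫ y, max (k - y) 0 ∂ν)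
    {S : Set ℝ} (hS : IsLowerSet S) (hb : BddAbove S) :
    ∫⁻ y, volume (S ∩ Ioi y) ∂μ ≤ ∫⁻ y, volume (S ∩ Ioi y) ∂ν := by
  rcases S.eq_empty_or_nonempty with rfl | hne
  · simp
  simp_rw [volume_inter_Ioi_of_isLowerSet hS hne hb]
  rw [← ofReal_integral_eq_lintegral_ofReal (hμ.integrable_put _)
      (ae_of_all _ fun y => le_max_right _ _),
    ← ofReal_integral_eq_lintegral_ofReal (hν.integrable_put _)
      (ae_of_all _ fun y => le_max_right _ _)]
  exact ENNReal.ofReal_le_ofReal (hput _)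

/-- Layer-cake representation of the part of a convex nonincreasing function to the left of `b`
as a superposition of put payoffs: the superlevel sets of `-φ'` are half-lines. -/
theorem ofReal_sub_eq_lintegral_volume {φ : ℝ → ℝ} (hφ : ConvexOn ℝ univ φ) (hanti : Antitone φ)
    (b y : ℝ) :
    ENNReal.ofReal (φ (min y b) - φ b) =
      ∫⁻ s in Ioi (0 : ℝ),
        volume ({t | t ≤ b ∧ s < -derivWithin φ (Ioi t) t} ∩ Ioi y) := by
  have hderiv : ∀ t, HasDerivWithinAt φ (derivWithin φ (Ioi t) t) (Ioi t) t := fun t =>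
    hφ.hasDerivWithinAt_rightDeriv_of_mem_interior (by simp)
  have hmono : Monotone fun t => derivWithin φ (Ioi t) t := by
    have := hφ.monotoneOn_rightDeriv
    rwa [interior_univ, monotoneOn_univ] at this
  have hneg : ∀ t, derivWithin φ (Ioi t) t ≤ 0 := fun t => (hanti.antitoneOn _).derivWithin_nonpos
  have hcont : Continuous φ := by
    rw [← continuousOn_univ]
    exact hφ.continuousOn isOpen_univ
  have hset : ∀ s, {t | t ≤ b ∧ s < -derivWithin φ (Ioi t) t} ∩ Ioi y =
      {t | s < -derivWithin φ (Ioi t) t} ∩ Ioc y b := fun s => by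
    ext t; simp only [mem_inter_iff, Set.mem_ofPred_eq, mem_Ioi, mem_Ioc]; tauto
  have hmeas : Measurable fun t => -derivWithin φ (Ioi t) t := hmono.measurable.neg
  have key : ∫⁻ t in Ioc y b, ENNReal.ofReal (-derivWithin φ (Ioi t) t) =
      ∫⁻ s in Ioi (0 : ℝ),
        volume ({t | t ≤ b ∧ s < -derivWithin φ (Ioi t) t} ∩ Ioi y) := by
    rw [lintegral_eq_lintegral_meas_lt _ (ae_of_all _ fun t => by simpa using hneg t)
      hmeas.aemeasurable]
    refine lintegral_congr fun s => ?_
    rw [Measure.restrict_apply (measurableSet_lt measurable_const hmeas), hset]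
  rw [← key]
  rcases le_total b y with hby | hyb
  · simp [hby]
  rw [min_eq_left hyb]
  have hint : IntervalIntegrable (fun t => derivWithin φ (Ioi t) t) volume y b :=
    hmono.intervalIntegrable
  have hftc := intervalIntegral.integral_eq_sub_of_hasDeriv_right hcont.continuousOn
    (fun t _ => hderiv t) hint
  have hint' : IntegrableOn (fun t => -derivWithin φ (Ioi t) t) (Ioc y b) :=
    ((intervalIntegrable_iff_integrableOn_Ioc_of_le hyb).1 hint).neg
  rw [← ofReal_integral_eq_lintegral_ofReal hint' (ae_of_all _ fun t => by simpa using hneg t),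
    integral_neg, ← intervalIntegral.integral_of_le hyb, hftc, neg_sub]

theorem lintegral_ofReal_sub_le {μ ν : Measure ℝ} (hμ : HasFirstMoment μ)
    (hν : HasFirstMoment ν)
    (hput : ∀ k : ℝ, ∫ y, max (k - y) 0 ∂μ ≤ ∫ y, max (k - y) 0 ∂ν)
    {φ : ℝ → ℝ} (hφ : ConvexOn ℝ univ φ) (hanti : Antitone φ) (b : ℝ) :
    ∫⁻ y, ENNReal.ofReal (φ (min y b) - φ b) ∂μ ≤
      ∫⁻ y, ENNReal.ofReal (φ (min y b) - φ b) ∂ν := by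
  have := hμ.finite
  have := hν.finite
  have hmono : Monotone fun t => derivWithin φ (Ioi t) t := by
    have := hφ.monotoneOn_rightDeriv
    rwa [interior_univ, monotoneOn_univ] at this
  have hmeas : Measurable fun p : ℝ × ℝ =>
      volume ({t | t ≤ b ∧ p.2 < -derivWithin φ (Ioi t) t} ∩ Ioi p.1) := by
    have hE : MeasurableSet {q : (ℝ × ℝ) × ℝ |
        (q.2 ≤ b ∧ q.1.2 < -derivWithin φ (Ioi q.2) q.2) ∧ q.1.1 < q.2} := by
      have h1 : Measurable fun q : (ℝ × ℝ) × ℝ => -derivWithin φ (Ioi q.2) q.2 :=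
        (hmono.measurable.comp measurable_snd).neg
      exact ((measurableSet_le measurable_snd measurable_const).inter
        (measurableSet_lt measurable_fst.snd h1)).inter
        (measurableSet_lt measurable_fst.fst measurable_snd)
    exact measurable_measure_prodMk_left hE
  simp_rw [ofReal_sub_eq_lintegral_volume hφ hanti b]
  rw [lintegral_lintegral_swap (f := fun y s =>
      volume ({t | t ≤ b ∧ s < -derivWithin φ (Ioi t) t} ∩ Ioi y)) hmeas.aemeasurable,
    lintegral_lintegral_swap (f := fun y s =>
      volume ({t | t ≤ b ∧ s < -derivWithin φ (Ioi t) t} ∩ Ioi y)) hmeas.aemeasurable]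
  refine lintegral_mono fun s => lintegral_volume_inter_Ioi_le hμ hν hput ?_ ?_
  · intro t t' htt' ht
    exact ⟨htt'.trans ht.1, ht.2.trans_le (neg_le_neg (hmono htt'))⟩
  · exact ⟨b, fun t ht => ht.1⟩

/-- The convex-decreasing order is generated by the constants and the put payoffs
`y ↦ (k - y)⁺`. -/
theorem convexDecreasingLE_of_put {μ ν : Measure ℝ} (hμ : HasFirstMoment μ)
    (hν : HasFirstMoment ν) (hmass : μ.real univ = ν.real univ)
    (hput : ∀ k : ℝ, ∫ y, max (k - y) 0 ∂μ ≤ ∫ y, max (k - y) 0 ∂ν) :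
    ConvexDecreasingLE μ ν := by
  refine ⟨hμ, hν, fun φ hφ hanti hint => ?_⟩
  have := hμ.finite
  have := hν.finite
  have hmeas : Measurable φ := hanti.measurable
  have hmeas' : ∀ b : ℝ, Measurable fun y => φ (min y b) := fun b =>
    hmeas.comp (measurable_id.min measurable_const)
  have hnn : ∀ b y : ℝ, 0 ≤ φ (min y b) - φ b := fun b y =>
    sub_nonneg.2 (hanti (min_le_right _ _))
  have hνb : ∀ b, Integrable (fun y => φ (min y b) - φ b) ν := fun b => by
    refine (hint.sub (integrable_const (φ b))).mono
      ((hmeas' b).sub measurable_const).aestronglyMeasurable (ae_of_all _ fun y => ?_)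
    rcases le_total y b with h | h
    · simp [min_eq_left h]
    · simp [min_eq_right h]
  have hle := lintegral_ofReal_sub_le hμ hν hput hφ hanti
  have hμb : ∀ b, Integrable (fun y => φ (min y b) - φ b) μ := fun b => by
    refine ⟨((hmeas' b).sub measurable_const).aestronglyMeasurable, ?_⟩
    rw [hasFiniteIntegral_iff_ofReal (ae_of_all _ (hnn b))]
    refine (hle b).trans_lt ?_
    rw [← hasFiniteIntegral_iff_ofReal (ae_of_all _ (hnn b))]
    exact (hνb b).2
  have hμint : Integrable φ μ := by
    -- to the right of `0`, `φ` lies between `φ 0` and its right tangent at `0`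
    refine Integrable.mono' (((hμb 0).add (integrable_const |φ 0|)).add
      (hμ.integrable.abs.const_mul (-derivWithin φ (Ioi 0) 0))) hmeas.aestronglyMeasurable
      (ae_of_all _ fun y => ?_)
    have hneg : derivWithin φ (Ioi 0) 0 ≤ 0 := (hanti.antitoneOn _).derivWithin_nonpos
    simp only [Pi.add_apply, Real.norm_eq_abs]
    rcases le_or_gt y 0 with h | h
    · rw [min_eq_left h]
      have h1 := hanti h
      have h2 : 0 ≤ -derivWithin φ (Ioi 0) 0 * |y| := mul_nonneg (by linarith) (abs_nonneg _)
      have h3 : |φ y| ≤ |φ y - φ 0| + |φ 0| := by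
        simpa using abs_add_le (φ y - φ 0) (φ 0)
      rw [abs_of_nonneg (by linarith : 0 ≤ φ y - φ 0)] at h3
      linarith
    · rw [min_eq_right h.le, abs_of_pos h]
      have h1 := hanti h.le
      have h2 := hφ.rightDeriv_le_slope_of_mem_interior (x := 0) (y := y) (by simp) (mem_univ _) h
      rw [slope_def_field, le_div_iff₀ (by linarith)] at h2
      have h3 : |φ y| ≤ |φ y - φ 0| + |φ 0| := by
        simpa using abs_add_le (φ y - φ 0) (φ 0)
      rw [abs_of_nonpos (by linarith : φ y - φ 0 ≤ 0)] at h3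
      linarith
  refine ⟨hμint, ?_⟩
  have htrunc : ∀ b, ∫ y, φ (min y b) ∂μ ≤ ∫ y, φ (min y b) ∂ν := fun b => by
    have h := hle b
    rw [← ofReal_integral_eq_lintegral_ofReal (hμb b) (ae_of_all _ (hnn b)),
      ← ofReal_integral_eq_lintegral_ofReal (hνb b) (ae_of_all _ (hnn b)),
      ENNReal.ofReal_le_ofReal_iff (integral_nonneg (hnn b))] at h
    have e : ∀ ρ : Measure ℝ, IsFiniteMeasure ρ → Integrable (fun y => φ (min y b) - φ b) ρ →
        ∫ y, φ (min y b) ∂ρ = ∫ y, (φ (min y b) - φ b) ∂ρ + ρ.real univ * φ b := by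
      intro ρ _ hρ
      have := integral_add hρ (integrable_const (φ b))
      simpa using this
    rw [e μ hμ.finite (hμb b), e ν hν.finite (hνb b), hmass]
    linarith
  have hlim : ∀ ρ : Measure ℝ, IsFiniteMeasure ρ → Integrable φ ρ →
      Tendsto (fun n : ℕ => ∫ y, φ (min y n) ∂ρ) atTop (𝓝 (∫ y, φ y ∂ρ)) := by
    intro ρ _ hρ
    refine tendsto_integral_of_dominated_convergence (fun y => |φ y| + |φ 0|)
      (fun n => (hmeas' n).aestronglyMeasurable) (hρ.abs.add (integrable_const _))
      (fun n => ae_of_all _ fun y => ?_) (ae_of_all _ fun y => ?_)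
    · rw [Real.norm_eq_abs]
      rcases le_total y n with h | h
      · rw [min_eq_left h]; linarith [abs_nonneg (φ 0)]
      · rw [min_eq_right h, abs_le]
        have h1 := hanti h
        have h2 := hanti (Nat.cast_nonneg n : (0 : ℝ) ≤ n)
        constructor <;> linarith [neg_abs_le (φ y), le_abs_self (φ 0), abs_nonneg (φ y),
          abs_nonneg (φ 0)]
    · refine tendsto_const_nhds.congr' ?_
      filter_upwards [eventually_ge_atTop ⌈y⌉₊] with n hn
      rw [min_eq_left (Nat.ceil_le.1 hn)]
  exact le_of_tendsto_of_tendsto' (hlim μ hμ.finite hμint) (hlim ν hν.finite hint)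
    fun n => htrunc n

theorem ConvexDecreasingLE.put_le {μ ν : Measure ℝ} (h : ConvexDecreasingLE μ ν) (k : ℝ) :
    ∫ y, max (k - y) 0 ∂μ ≤ ∫ y, max (k - y) 0 ∂ν :=
  (h.le _ (convexOn_put k) (antitone_put k) (h.right.integrable_put k)).2

theorem ConvexDecreasingLE.mass_eq {μ ν : Measure ℝ} (h : ConvexDecreasingLE μ ν) :
    μ.real univ = ν.real univ := by
  have := h.left.finite
  have := h.right.finite
  have h1 := (h.le (fun _ => 1) (convexOn_const _ convex_univ) antitone_const
    (integrable_const _)).2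
  have h2 := (h.le (fun _ => -1) (convexOn_const _ convex_univ) antitone_const
    (integrable_const _)).2
  simp at h1 h2
  exact le_antisymm h1 h2

/-- The difference quotients in `k` of the put payoffs converge to the indicator function of
`(-∞, k]`, so put values determine a measure. -/
theorem eq_of_put_eq {μ ν : Measure ℝ} (hμ : HasFirstMoment μ) (hν : HasFirstMoment ν)
    (h : ∀ k : ℝ, ∫ y, max (k - y) 0 ∂μ = ∫ y, max (k - y) 0 ∂ν) : μ = ν := by
  have := hμ.finite
  have := hν.finite
  have hlim : ∀ ρ : Measure ℝ, HasFirstMoment ρ → ∀ k : ℝ,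
      Tendsto (fun n : ℕ => ((n : ℝ) + 1) *
        (∫ y, max (k + 1 / ((n : ℝ) + 1) - y) 0 ∂ρ - ∫ y, max (k - y) 0 ∂ρ))
        atTop (𝓝 (ρ.real (Iic k))) := by
    intro ρ hρ k
    have := hρ.finite
    have e1 : ρ.real (Iic k) = ∫ y, (Iic k).indicator (fun _ => (1 : ℝ)) y ∂ρ := by
      rw [integral_indicator measurableSet_Iic]; simp
    have e2 : ∀ n : ℕ, ((n : ℝ) + 1) *
        (∫ y, max (k + 1 / ((n : ℝ) + 1) - y) 0 ∂ρ - ∫ y, max (k - y) 0 ∂ρ) =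
        ∫ y, ((n : ℝ) + 1) * (max (k + 1 / ((n : ℝ) + 1) - y) 0 - max (k - y) 0) ∂ρ := by
      intro n
      rw [integral_const_mul, integral_sub (hρ.integrable_put _) (hρ.integrable_put _)]
    simp_rw [e1, e2]
    refine tendsto_integral_of_dominated_convergence (fun _ => 1)
      (fun n => (((hρ.integrable_put _).sub (hρ.integrable_put _)).const_mul _).1)
      (integrable_const _) (fun n => ae_of_all _ fun y => ?_) (ae_of_all _ fun y => ?_)
    · have hn : (0 : ℝ) < n + 1 := by positivity
      have hd : (0 : ℝ) < 1 / ((n : ℝ) + 1) := by positivity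
      have h0 : max (k - y) 0 ≤ max (k + 1 / ((n : ℝ) + 1) - y) 0 :=
        max_le_max (by linarith) le_rfl
      have h1 : max (k + 1 / ((n : ℝ) + 1) - y) 0 - max (k - y) 0 ≤ 1 / ((n : ℝ) + 1) := by
        have := le_max_left (k - y) 0
        have := le_max_right (k - y) 0
        rw [sub_le_iff_le_add]
        exact max_le (by linarith) (by linarith)
      rw [Real.norm_eq_abs, abs_of_nonneg (mul_nonneg hn.le (by linarith))]
      calc _ ≤ ((n : ℝ) + 1) * (1 / ((n : ℝ) + 1)) := by gcongr
        _ = 1 := by field_simp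
    · refine tendsto_const_nhds.congr' ?_
      rcases le_or_gt y k with hy | hy
      · refine Eventually.of_forall fun n => ?_
        have hd : (0 : ℝ) < 1 / ((n : ℝ) + 1) := by positivity
        dsimp only
        rw [indicator_of_mem (mem_Iic.2 hy), max_eq_left (by linarith), max_eq_left (by linarith)]
        field_simp
        ring
      · have ht : Tendsto (fun n : ℕ => 1 / ((n : ℝ) + 1)) atTop (𝓝 0) :=
          tendsto_one_div_add_atTop_nhds_zero_nat
        filter_upwards [ht.eventually (gt_mem_nhds (sub_pos.2 hy))] with n hn
        rw [indicator_of_notMem (by simpa using hy), max_eq_right (by linarith),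
          max_eq_right (by linarith)]
        simp
  refine Measure.ext_of_Iic _ _ fun k => ?_
  have h1 := hlim μ hμ k
  simp_rw [h] at h1
  have h2 := tendsto_nhds_unique h1 (hlim ν hν k)
  rwa [measureReal_eq_measureReal_iff] at h2

theorem IsShadow.eq {μ ν θ η : Measure ℝ} (h₁ : IsShadow μ ν θ) (h₂ : IsShadow μ ν η) :
    θ = η := by
  have h := h₁.least η h₂.mem
  have h' := h₂.least θ h₁.mem
  exact eq_of_put_eq h.left h.right fun k => le_antisymm (h.put_le k) (h'.put_le k)

/-! ### Comparison of put values on an open set of domination -/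

theorem HasFirstMoment.tendsto_put_atBot {μ : Measure ℝ} (hμ : HasFirstMoment μ) :
    Tendsto (fun k : ℝ => ∫ y, max (k - y) 0 ∂μ) atBot (𝓝 0) := by
  have h : Tendsto (fun k : ℝ => ∫ y, max (k - y) 0 ∂μ) atBot (𝓝 (∫ _, (0 : ℝ) ∂μ)) := by
    refine tendsto_integral_filter_of_dominated_convergence (fun y => max (0 - y) 0)
      (Eventually.of_forall fun k => (hμ.integrable_put k).1) ?_ (hμ.integrable_put 0)
      (ae_of_all _ fun y => ?_)
    · filter_upwards [eventually_le_atBot (0 : ℝ)] with k hk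
      refine ae_of_all _ fun y => ?_
      rw [Real.norm_eq_abs, abs_of_nonneg (le_max_right _ _)]
      exact max_le_max (by linarith) le_rfl
    · refine tendsto_const_nhds.congr' ?_
      filter_upwards [eventually_le_atBot y] with k hk
      rw [max_eq_right (by linarith)]
  simpa using h

theorem integral_le_of_restrict_le {θ η : Measure ℝ} {V : Set ℝ}
    (h : η.restrict V ≤ θ.restrict V) {g : ℝ → ℝ} (hg : ∀ y, 0 ≤ g y)
    (hgV : ∀ y ∉ V, g y = 0) (hint : Integrable g θ) : ∫ y, g y ∂η ≤ ∫ y, g y ∂θ := by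
  rw [← setIntegral_eq_integral_of_forall_compl_eq_zero (μ := η) (s := V) hgV,
    ← setIntegral_eq_integral_of_forall_compl_eq_zero (μ := θ) (s := V) hgV]
  exact integral_mono_measure h (ae_of_all _ hg) hint.restrict

/-- If `η ≤ θ` on an interval `(l, r)`, the difference of the put values of `θ` and `η` is
convex there. -/
theorem put_sub_put_convex {θ η : Measure ℝ} (hθ : HasFirstMoment θ) (hη : HasFirstMoment η)
    {V : Set ℝ} (hV : η.restrict V ≤ θ.restrict V) {l k r : ℝ} (hlk : l < k) (hkr : k < r)
    (hlr : Ioo l r ⊆ V) :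
    (r - l) * (∫ y, max (k - y) 0 ∂θ - ∫ y, max (k - y) 0 ∂η) ≤
      (r - k) * (∫ y, max (l - y) 0 ∂θ - ∫ y, max (l - y) 0 ∂η) +
      (k - l) * (∫ y, max (r - y) 0 ∂θ - ∫ y, max (r - y) 0 ∂η) := by
  have hint : ∀ ρ, HasFirstMoment ρ → Integrable (fun y : ℝ => (r - k) * max (l - y) 0 +
      (k - l) * max (r - y) 0 - (r - l) * max (k - y) 0) ρ := fun ρ hρ =>
    (((hρ.integrable_put l).const_mul _).add ((hρ.integrable_put r).const_mul _)).sub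
      ((hρ.integrable_put k).const_mul _)
  have hval : ∀ ρ, HasFirstMoment ρ → ∫ y, ((r - k) * max (l - y) 0 +
      (k - l) * max (r - y) 0 - (r - l) * max (k - y) 0) ∂ρ =
      (r - k) * ∫ y, max (l - y) 0 ∂ρ + (k - l) * ∫ y, max (r - y) 0 ∂ρ -
        (r - l) * ∫ y, max (k - y) 0 ∂ρ := fun ρ hρ => by
    rw [integral_sub, integral_add, integral_const_mul, integral_const_mul, integral_const_mul]
    · exact (hρ.integrable_put l).const_mul _
    · exact (hρ.integrable_put r).const_mul _
    · exact ((hρ.integrable_put l).const_mul _).add ((hρ.integrable_put r).const_mul _)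
    · exact (hρ.integrable_put k).const_mul _
  have key := integral_le_of_restrict_le hV (g := fun y => (r - k) * max (l - y) 0 +
      (k - l) * max (r - y) 0 - (r - l) * max (k - y) 0) ?_ ?_ (hint θ hθ)
  · rw [hval θ hθ, hval η hη] at key
    linarith
  · intro y
    have h1 : 0 ≤ (r - k) * (max (l - y) 0 - (l - y)) :=
      mul_nonneg (by linarith) (sub_nonneg.2 (le_max_left _ _))
    have h2 : 0 ≤ (k - l) * (max (r - y) 0 - (r - y)) :=
      mul_nonneg (by linarith) (sub_nonneg.2 (le_max_left _ _))
    have h3 : 0 ≤ (r - k) * max (l - y) 0 := mul_nonneg (by linarith) (le_max_right _ _)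
    have h4 : 0 ≤ (k - l) * max (r - y) 0 := mul_nonneg (by linarith) (le_max_right _ _)
    rcases le_total (k - y) 0 with h | h
    · rw [max_eq_right h]; linarith
    · rw [max_eq_left h]; linarith
  · intro y hy
    rcases le_or_gt y l with h | h
    · rw [max_eq_left (by linarith), max_eq_left (by linarith), max_eq_left (by linarith)]; ring
    · have h' : r ≤ y := by
        by_contra hc
        exact hy (hlr ⟨h, not_le.1 hc⟩)
      rw [max_eq_right (by linarith), max_eq_right (by linarith), max_eq_right (by linarith)]; ring

/-- If `θ` and `η` have the same mass and `η ≤ θ` on `(l, ∞)`, the difference of the put values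
of `θ` and `η` is nonincreasing there. -/
theorem put_sub_put_antitone {θ η : Measure ℝ} (hθ : HasFirstMoment θ) (hη : HasFirstMoment η)
    (hmass : θ.real univ = η.real univ) {V : Set ℝ} (hV : η.restrict V ≤ θ.restrict V)
    {l k : ℝ} (hlk : l < k) (hl : Ioi l ⊆ V) :
    ∫ y, max (k - y) 0 ∂θ - ∫ y, max (k - y) 0 ∂η ≤
      ∫ y, max (l - y) 0 ∂θ - ∫ y, max (l - y) 0 ∂η := by
  have := hθ.finite
  have := hη.finite
  have hval : ∀ ρ, HasFirstMoment ρ → ∫ y, ((k - l) + max (l - y) 0 - max (k - y) 0) ∂ρ =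
      (k - l) * ρ.real univ + ∫ y, max (l - y) 0 ∂ρ - ∫ y, max (k - y) 0 ∂ρ := fun ρ hρ => by
    have := hρ.finite
    rw [integral_sub, integral_add (integrable_const _) (hρ.integrable_put l), integral_const,
      smul_eq_mul, mul_comm]
    · exact (integrable_const _).add (hρ.integrable_put l)
    · exact hρ.integrable_put k
  have key := integral_le_of_restrict_le hV
    (g := fun y => (k - l) + max (l - y) 0 - max (k - y) 0) ?_ ?_
    (((integrable_const _).add (hθ.integrable_put l)).sub (hθ.integrable_put k))
  · rw [hval θ hθ, hval η hη, hmass] at key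
    linarith
  · intro y
    have h1 := le_max_left (l - y) 0
    have h2 := le_max_right (l - y) 0
    have h3 : max (k - y) 0 ≤ (k - l) + max (l - y) 0 := max_le (by linarith) (by linarith)
    linarith
  · intro y hy
    have h : y ≤ l := not_lt.1 fun h => hy (hl h)
    rw [max_eq_left (by linarith), max_eq_left (by linarith)]; ring

/-- Let `η ≤ θ` on an open set `V`. Then the put values of `θ` and `η` only have to be compared
outside `V`: on each connected component of `V` their difference is convex, and it is
nonincreasing if the component is unbounded above, so it is controlled by its values at the
endpoints and its limit `0` at `-∞`. -/
theorem put_le_of_restrict_le {θ η : Measure ℝ} (hθ : HasFirstMoment θ) (hη : HasFirstMoment η)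
    (hmass : θ.real univ = η.real univ) {V : Set ℝ} (hVo : IsOpen V)
    (hV : η.restrict V ≤ θ.restrict V)
    (hput : ∀ k ∉ V, ∫ y, max (k - y) 0 ∂θ ≤ ∫ y, max (k - y) 0 ∂η) (k : ℝ) :
    ∫ y, max (k - y) 0 ∂θ ≤ ∫ y, max (k - y) 0 ∂η := by
  by_cases hk : k ∉ V
  · exact hput k hk
  rw [not_not] at hk
  refine le_of_forall_pos_le_add fun ε hε => ?_
  -- `l` is the left endpoint of the component of `k` if that is finite, else far to the left
  obtain ⟨l, hlk, hlV, hl⟩ : ∃ l < k, Ioc l k ⊆ V ∧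
      ∫ y, max (l - y) 0 ∂θ - ∫ y, max (l - y) 0 ∂η ≤ ε := by
    by_cases hne : (Vᶜ ∩ Iic k).Nonempty
    · have hb : BddAbove (Vᶜ ∩ Iic k) := ⟨k, fun z hz => hz.2⟩
      have hmem := (hVo.isClosed_compl.inter isClosed_Iic).csSup_mem hne hb
      refine ⟨sSup (Vᶜ ∩ Iic k), lt_of_le_of_ne hmem.2 fun h => hmem.1 (by rwa [h]), ?_, ?_⟩
      · intro z hz
        by_contra hzV
        exact absurd (le_csSup hb ⟨hzV, hz.2⟩) (not_le.2 hz.1)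
      · linarith [hput _ hmem.1]
    · obtain ⟨l, hl, hlk⟩ := ((hθ.tendsto_put_atBot.eventually (gt_mem_nhds hε)).and
        (eventually_lt_atBot k)).exists
      refine ⟨l, hlk, fun z hz => ?_, ?_⟩
      · by_contra hzV
        exact hne ⟨z, hzV, hz.2⟩
      · have : 0 ≤ ∫ y, max (l - y) 0 ∂η := integral_nonneg fun y => le_max_right _ _
        linarith
  by_cases hne : (Vᶜ ∩ Ici k).Nonempty
  · have hb : BddBelow (Vᶜ ∩ Ici k) := ⟨k, fun z hz => hz.2⟩
    have hmem := (hVo.isClosed_compl.inter isClosed_Ici).csInf_mem hne hb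
    set r := sInf (Vᶜ ∩ Ici k)
    have hkr : k < r := lt_of_le_of_ne hmem.2 fun h => hmem.1 (by rwa [← h])
    have hlr : Ioo l r ⊆ V := fun z hz => by
      rcases le_total z k with h | h
      · exact hlV ⟨hz.1, h⟩
      · by_contra hzV
        exact absurd (csInf_le hb ⟨hzV, h⟩) (not_le.2 hz.2)
    have h1 := put_sub_put_convex hθ hη hV hlk hkr hlr
    have h2 := mul_nonneg (sub_nonneg.2 hlk.le) (sub_nonneg.2 (hput r hmem.1))
    have h3 := mul_le_mul_of_nonneg_left hl (sub_nonneg.2 hkr.le)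
    have h4 := mul_nonneg (sub_nonneg.2 hlk.le) hε.le
    have h5 : (r - l) * (∫ y, max (k - y) 0 ∂θ - ∫ y, max (k - y) 0 ∂η) ≤ (r - l) * ε := by
      linarith
    linarith [le_of_mul_le_mul_left h5 (by linarith)]
  · have hlV' : Ioi l ⊆ V := fun z hz => by
      rcases le_total z k with h | h
      · exact hlV ⟨hz, h⟩
      · by_contra hzV
        exact hne ⟨z, hzV, h⟩
    linarith [put_sub_put_antitone hθ hη hmass hV hlk hlV']

/-! ### Put values of the marginals of a supermartingale coupling -/

theorem hasFirstMoment_fst {T : Measure (ℝ × ℝ)} [IsFiniteMeasure T]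
    (hT : Integrable (fun p : ℝ × ℝ => p.1) T) : HasFirstMoment T.fst :=
  ⟨inferInstance, (integrable_map_measure aestronglyMeasurable_id
    measurable_fst.aemeasurable).2 hT⟩

theorem hasFirstMoment_snd {T : Measure (ℝ × ℝ)} [IsFiniteMeasure T]
    (hT : Integrable (fun p : ℝ × ℝ => p.2) T) : HasFirstMoment T.snd :=
  ⟨inferInstance, (integrable_map_measure aestronglyMeasurable_id
    measurable_snd.aemeasurable).2 hT⟩

theorem integral_put_fst (T : Measure (ℝ × ℝ)) (k : ℝ) :
    ∫ x, max (k - x) 0 ∂T.fst = ∫ p : ℝ × ℝ, max (k - p.1) 0 ∂T :=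
  integral_map measurable_fst.aemeasurable (by fun_prop)

theorem integral_put_snd (T : Measure (ℝ × ℝ)) (k : ℝ) :
    ∫ y, max (k - y) 0 ∂T.snd = ∫ p : ℝ × ℝ, max (k - p.2) 0 ∂T :=
  integral_map measurable_snd.aemeasurable (by fun_prop)

/-- The marginals of a supermartingale coupling are ordered. For the put with strike `k` it suffices
to exercise exactly if `X < k`, so no disintegration of the coupling is needed. -/
theorem IsSupermartingale.convexDecreasingLE {T : Measure (ℝ × ℝ)} [IsFiniteMeasure T]
    (hT : IsSupermartingale T) : ConvexDecreasingLE T.fst T.snd := by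
  have hi1 := hT.integrable_fst
  have hi2 := hT.integrable_snd
  refine convexDecreasingLE_of_put (hasFirstMoment_fst hi1) (hasFirstMoment_snd hi2)
    (by simp only [measureReal_def, Measure.fst_univ, Measure.snd_univ]) fun k => ?_
  rw [integral_put_fst, integral_put_snd]
  have hS : MeasurableSet (Prod.fst ⁻¹' Iio k : Set (ℝ × ℝ)) := measurable_fst measurableSet_Iio
  have hint : Integrable (fun p : ℝ × ℝ => max (k - p.2) 0) T :=
    ((integrable_const k).sub hi2).sup (integrable_const 0)
  calc ∫ p : ℝ × ℝ, max (k - p.1) 0 ∂T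
      = ∫ p in Prod.fst ⁻¹' Iio k, (k - p.1) ∂T := by
        rw [← integral_indicator hS]
        congr 1 with p
        by_cases hp : p.1 < k
        · rw [indicator_of_mem (by exact hp), max_eq_left (by linarith)]
        · rw [indicator_of_notMem (by exact hp), max_eq_right (by linarith)]
    _ ≤ ∫ p in Prod.fst ⁻¹' Iio k, (k - p.2) ∂T := by
        rw [integral_sub (integrable_const k) hi1.restrict,
          integral_sub (integrable_const k) hi2.restrict]
        linarith [hT.setIntegral_le _ (measurableSet_Iio (a := k))]
    _ ≤ ∫ p in Prod.fst ⁻¹' Iio k, max (k - p.2) 0 ∂T :=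
        integral_mono ((integrable_const k).sub hi2.restrict) hint.restrict
          fun p => le_max_left _ _
    _ ≤ ∫ p : ℝ × ℝ, max (k - p.2) 0 ∂T :=
        setIntegral_le_integral hint (ae_of_all _ fun p => le_max_right _ _)

/-- If a level `k` is not crossed by the martingale part of a coupling `T` concentrated on `G`,
and the remaining part is transported above `k`, then the put with strike `k` is worth no more
under the second marginal than under the first. -/
theorem put_snd_le_put_fst {T : Measure (ℝ × ℝ)} [IsFiniteMeasure T]
    (hi1 : Integrable (fun p : ℝ × ℝ => p.1) T) (hi2 : Integrable (fun p : ℝ × ℝ => p.2) T)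
    {G : Set (ℝ × ℝ)} {M : Set ℝ} (hM : MeasurableSet M)
    (hmart : ∀ A, MeasurableSet A → A ⊆ M →
      ∫ p in Prod.fst ⁻¹' A, p.2 ∂T = ∫ p in Prod.fst ⁻¹' A, p.1 ∂T)
    (hG : ∀ᵐ p ∂T, p ∈ G) (hnd : Nondegenerate G M) {k : ℝ}
    (hk₁ : ∀ x y, (x, y) ∈ G → x ∉ M → k ≤ y)
    (hk₂ : ∀ x y₁ y₂, (x, y₁) ∈ G → (x, y₂) ∈ G → x ∈ M → y₁ < k → k < y₂ → False) :
    ∫ y, max (k - y) 0 ∂T.snd ≤ ∫ x, max (k - x) 0 ∂T.fst := by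
  rw [integral_put_fst, integral_put_snd]
  have hA : MeasurableSet (M ∩ Iio k) := hM.inter measurableSet_Iio
  have hS : MeasurableSet (Prod.fst ⁻¹' (M ∩ Iio k) : Set (ℝ × ℝ)) := measurable_fst hA
  have hint : Integrable (fun p : ℝ × ℝ => max (k - p.1) 0) T :=
    ((integrable_const k).sub hi1).sup (integrable_const 0)
  calc ∫ p : ℝ × ℝ, max (k - p.2) 0 ∂T
      = ∫ p in Prod.fst ⁻¹' (M ∩ Iio k), (k - p.2) ∂T := by
        -- a fibre over `M` on one side of `k` starts on that side, by nondegeneracy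
        rw [← integral_indicator hS]
        refine integral_congr_ae ?_
        filter_upwards [hG] with p hp
        obtain ⟨x, y⟩ := p
        dsimp only
        by_cases hxM : x ∈ M
        · by_cases hxk : x < k
          · rw [indicator_of_mem (by exact ⟨hxM, hxk⟩), max_eq_left]
            by_contra hc
            obtain ⟨y', hy', hy'G⟩ := hnd.exists_lt x y hp (by linarith)
            exact hk₂ x y' y hy'G hp hxM (by linarith) (by linarith)
          · rw [indicator_of_notMem (fun h => hxk h.2), max_eq_right]
            by_contra hc
            obtain ⟨y', hy', hy'G⟩ := hnd.exists_gt x y hxM hp (by linarith)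
            exact hk₂ x y y' hp hy'G hxM (by linarith) (by linarith)
        · rw [indicator_of_notMem (fun h => hxM h.1), max_eq_right]
          linarith [hk₁ x y hp hxM]
    _ = ∫ p in Prod.fst ⁻¹' (M ∩ Iio k), (k - p.1) ∂T := by
        rw [integral_sub (integrable_const k) hi1.restrict,
          integral_sub (integrable_const k) hi2.restrict, hmart _ hA inter_subset_left]
    _ ≤ ∫ p in Prod.fst ⁻¹' (M ∩ Iio k), max (k - p.1) 0 ∂T :=
        integral_mono ((integrable_const k).sub hi1.restrict) hint.restrict
          fun p => le_max_left _ _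
    _ ≤ ∫ p : ℝ × ℝ, max (k - p.1) 0 ∂T :=
        setIntegral_le_integral hint (ae_of_all _ fun p => le_max_right _ _)

/-! ### Shadows from monotone supports -/

/-- Let `J` be a set of initial positions such that no point of `Γ` starting outside `J` ends
strictly between two points of a fibre `Γ_x`, `x ∈ J`, or strictly above a point of a fibre
`Γ_x`, `x ∈ J \ M`. Then `P` transports the restriction of its first marginal to `J` to its
shadow. -/
theorem isShadow_of_separated {P : Measure (ℝ × ℝ)} [IsFiniteMeasure P]
    (hP : IsSupermartingale P) {Γ : Set (ℝ × ℝ)} {M J : Set ℝ}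
    (hM : MeasurableSet M) (hJ : MeasurableSet J) (hPΓ : P Γᶜ = 0)
    (hPM : IsMartingale (P.restrict (M ×ˢ (univ : Set ℝ)))) (hnd : Nondegenerate Γ M)
    (hfirst : ∀ x y x' y', (x, y) ∈ Γ → (x', y') ∈ Γ → x ∈ J → x' ∉ J → x ∉ M → y' ≤ y)
    (hsecond : ∀ x y₁ y₂ x' y', (x, y₁) ∈ Γ → (x, y₂) ∈ Γ → (x', y') ∈ Γ → x ∈ J → x' ∉ J →
      y₁ < y₂ → y' ∉ Ioo y₁ y₂) :
    IsShadow (P.fst.restrict J) P.snd (P.restrict (J ×ˢ (univ : Set ℝ))).snd := by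
  have hset : ∀ A : Set ℝ, A ×ˢ (univ : Set ℝ) = Prod.fst ⁻¹' A := fun A => prod_univ
  have hJ' : MeasurableSet (Prod.fst ⁻¹' J : Set (ℝ × ℝ)) := measurable_fst hJ
  rw [hset] at hPM ⊢
  set T := P.restrict (Prod.fst ⁻¹' J) with hT_def
  have hfst : P.fst.restrict J = T.fst := Measure.restrict_map measurable_fst hJ
  have hres : ∀ A : Set ℝ, MeasurableSet A →
      T.restrict (Prod.fst ⁻¹' A) = P.restrict (Prod.fst ⁻¹' (A ∩ J)) := fun A hA => by
    rw [hT_def, Measure.restrict_restrict (measurable_fst hA), preimage_inter]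
  have hT : IsSupermartingale T := by
    refine ⟨hP.integrable_fst.restrict, hP.integrable_snd.restrict, fun A hA => ?_⟩
    rw [hres A hA]
    exact hP.setIntegral_le _ (hA.inter hJ)
  have hmart : ∀ A, MeasurableSet A → A ⊆ M →
      ∫ p in Prod.fst ⁻¹' A, p.2 ∂T = ∫ p in Prod.fst ⁻¹' A, p.1 ∂T := fun A hA hAM => by
    have h := hPM.setIntegral_eq _ (hA.inter hJ)
    rwa [Measure.restrict_restrict (measurable_fst (hA.inter hJ)), ← preimage_inter,
      inter_eq_left.2 (inter_subset_left.trans hAM), ← hres A hA] at h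
  have hG : ∀ᵐ p ∂T, p ∈ Γ ∩ Prod.fst ⁻¹' J :=
    (ae_restrict_of_ae (mem_ae_iff.2 hPΓ)).and (ae_restrict_mem hJ')
  have hndG : Nondegenerate (Γ ∩ Prod.fst ⁻¹' J) M :=
    ⟨fun x y h hxy => let ⟨y', h1, h2⟩ := hnd.exists_lt x y h.1 hxy; ⟨y', h1, h2, h.2⟩,
      fun x y hx h hxy => let ⟨y', h1, h2⟩ := hnd.exists_gt x y hx h.1 hxy; ⟨y', h1, h2, h.2⟩⟩
  rw [hfst]
  have hcd := hT.convexDecreasingLE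
  refine ⟨⟨hcd, Measure.map_mono Measure.restrict_le_self measurable_snd⟩, ?_⟩
  rintro η ⟨hη, hην⟩
  have hmass : T.snd.real univ = η.real univ := hcd.mass_eq.symm.trans hη.mass_eq
  -- `V` consists of the points strictly between two points of a fibre `Γ_x`, `x ∈ J`, or above
  -- a point of a fibre `Γ_x`, `x ∈ J \ M`. By assumption no mass starting outside `J` reaches `V`,
  -- so the second marginals of `T` and `P` coincide there, and thus `η ≤ T.snd` on `V`.
  let V : Set ℝ := ⋃ x ∈ J, ⋃ y ∈ {y | (x, y) ∈ Γ},
    (⋃ y₂ ∈ {y₂ | (x, y₂) ∈ Γ}, Ioo y y₂) ∪ ⋃ (_ : x ∉ M), Ioi y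
  have hVmem : ∀ z, z ∈ V ↔ ∃ x ∈ J, ∃ y, (x, y) ∈ Γ ∧
      ((y < z ∧ ∃ y₂, (x, y₂) ∈ Γ ∧ z < y₂) ∨ (x ∉ M ∧ y < z)) := fun z => by
    simp [V]
  have hVo : IsOpen V :=
    isOpen_biUnion fun x _ => isOpen_biUnion fun y _ =>
      (isOpen_biUnion fun y₂ _ => isOpen_Ioo).union (isOpen_iUnion fun _ => isOpen_Ioi)
  have hnull : P (Prod.snd ⁻¹' V \ Prod.fst ⁻¹' J) = 0 := by
    refine measure_mono_null ?_ hPΓ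
    rintro ⟨x', y'⟩ ⟨hy', hx'⟩ hΓ'
    obtain ⟨x, hx, y, hxy, ⟨h₁, y₂, hxy₂, h₂⟩ | ⟨hxM, h⟩⟩ := (hVmem y').1 hy'
    · exact hsecond x y y₂ x' y' hxy hxy₂ hΓ' hx hx' (h₁.trans h₂) ⟨h₁, h₂⟩
    · exact absurd (hfirst x y x' y' hxy hΓ' hx hx' hxM) (not_le.2 h)
  have hVle : η.restrict V ≤ T.snd.restrict V := by
    refine (Measure.restrict_mono le_rfl hην).trans (Measure.le_iff.2 fun s hs => ?_)
    have hsV := hs.inter hVo.measurableSet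
    rw [Measure.restrict_apply hs, Measure.restrict_apply hs, Measure.snd_apply hsV,
      Measure.snd_apply hsV, hT_def, Measure.restrict_apply (measurable_snd hsV)]
    refine (measure_le_inter_add_sdiff P _ (Prod.fst ⁻¹' J)).trans ?_
    rw [measure_mono_null (sdiff_subset_sdiff_left (preimage_mono inter_subset_right)) hnull,
      add_zero]
  refine convexDecreasingLE_of_put hcd.right hη.right hmass
    (put_le_of_restrict_le hcd.right hη.right hmass hVo hVle fun k hk => ?_)
  refine (put_snd_le_put_fst hT.integrable_fst hT.integrable_snd hM hmart hG hndG
    (fun x y h hxM => ?_) fun x y₁ y₂ h₁ h₂ _ hk₁ hk₂ => ?_).trans (hη.put_le k)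
  · by_contra hc
    exact hk ((hVmem k).2 ⟨x, h.2, y, h.1, Or.inr ⟨hxM, not_le.1 hc⟩⟩)
  · exact hk ((hVmem k).2 ⟨x, h₁.2, y₁, h₁.1, Or.inl ⟨hk₁, y₂, h₂.1, hk₂⟩⟩)

/-- A coupling is determined by its restrictions to a family of strips `J x × ℝ`, if the sets
`J x` determine finite measures on `ℝ`. -/
theorem eq_of_restrict_prod_snd_eq {P Q : Measure (ℝ × ℝ)} [IsFiniteMeasure P] [IsFiniteMeasure Q]
    {J : ℝ → Set ℝ} (hJ : ∀ x, MeasurableSet (J x))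
    (hext : ∀ ρ σ : Measure ℝ, IsFiniteMeasure ρ → IsFiniteMeasure σ →
      (∀ x, ρ (J x) = σ (J x)) → ρ = σ)
    (h : ∀ x, (Q.restrict (J x ×ˢ (univ : Set ℝ))).snd =
      (P.restrict (J x ×ˢ (univ : Set ℝ))).snd) : Q = P := by
  refine Measure.ext_prod fun {s t} hs ht => ?_
  have e : ∀ (T : Measure (ℝ × ℝ)) (s : Set ℝ), MeasurableSet s →
      (T.restrict (Prod.snd ⁻¹' t)).fst s = T (s ×ˢ t) := fun T s hs => by
    rw [Measure.fst_apply hs, Measure.restrict_apply (measurable_fst hs)]; rfl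
  have e' : ∀ (T : Measure (ℝ × ℝ)) x,
      (T.restrict (J x ×ˢ (univ : Set ℝ))).snd t = T (J x ×ˢ t) := fun T x => by
    rw [Measure.snd_apply ht, Measure.restrict_apply (measurable_snd ht)]
    congr 1; ext p; simp [and_comm]
  have := hext (Q.restrict (Prod.snd ⁻¹' t)).fst (P.restrict (Prod.snd ⁻¹' t)).fst inferInstance
    inferInstance fun x => by rw [e _ _ (hJ x), e _ _ (hJ x), ← e', ← e', h]
  rw [← e _ _ hs, ← e _ _ hs, this]

end SupermartingaleTransport

theorem mainTheorem3 (μ ν : Measure ℝ) [IsProbabilityMeasure μ] [IsProbabilityMeasure ν]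
    (hμ : Integrable (fun x : ℝ => x) μ) (hν : Integrable (fun y : ℝ => y) ν)
    (Γ : Set (ℝ × ℝ)) (M : Set ℝ) (hΓ : MeasurableSet Γ) (hM : MeasurableSet M)
    (hnd : SupermartingaleTransport.Nondegenerate Γ M)
    (P : Measure (ℝ × ℝ))
    (hP : P ∈ SupermartingaleTransport.supermartingaleCouplings μ ν)
    (hPΓ : P Γᶜ = 0)
    (hPM : SupermartingaleTransport.IsMartingale (P.restrict (M ×ˢ (univ : Set ℝ)))) :
    (SupermartingaleTransport.FirstOrderRightMonotone Γ M →
      SupermartingaleTransport.SecondOrderLeftMonotone Γ →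
      ∀ Q : Measure (ℝ × ℝ),
        SupermartingaleTransport.IsIncreasingSupermartingaleTransport μ ν Q ↔ Q = P) ∧
    (SupermartingaleTransport.FirstOrderLeftMonotone Γ M →
      SupermartingaleTransport.SecondOrderRightMonotone Γ →
      ∀ Q : Measure (ℝ × ℝ),
        SupermartingaleTransport.IsDecreasingSupermartingaleTransport μ ν Q ↔ Q = P) := by
  obtain ⟨rfl, rfl, hPs⟩ := hP
  -- a measure on the plane is finite if its first marginal is
  have hfin : ∀ Q : Measure (ℝ × ℝ), Q.fst = P.fst → IsFiniteMeasure Q := fun Q hQ =>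
    ⟨by rw [← Measure.fst_univ, hQ]; exact measure_lt_top _ _⟩
  have := hfin P rfl
  refine ⟨fun hfirst hsecond => ?_, fun hfirst hsecond => ?_⟩
  · have hsh := fun a : ℝ => SupermartingaleTransport.isShadow_of_separated hPs hM
      (measurableSet_Iic (a := a)) hPΓ hPM hnd
      (fun x y x' y' h h' hx hx' hxM =>
        hfirst x y x' y' h h' (lt_of_le_of_lt hx (not_le.1 hx')) hxM)
      (fun x y₁ y₂ x' y' h₁ h₂ h' hx hx' hy =>
        hsecond x y₁ y₂ x' y' h₁ h₂ h' hy (lt_of_le_of_lt hx (not_le.1 hx')))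
    refine fun Q => ⟨fun hQ => ?_, by rintro rfl; exact ⟨rfl, hsh⟩⟩
    have := hfin Q hQ.fst_eq
    exact SupermartingaleTransport.eq_of_restrict_prod_snd_eq (fun _ => measurableSet_Iic)
      (fun ρ σ _ _ h => Measure.ext_of_Iic ρ σ h) fun x => (hQ.shadow x).eq (hsh x)
  · have hsh := fun a : ℝ => SupermartingaleTransport.isShadow_of_separated hPs hM
      (measurableSet_Ici (a := a)) hPΓ hPM hnd
      (fun x y x' y' h h' hx hx' hxM =>
        hfirst x' y' x y h' h (lt_of_lt_of_le (not_le.1 hx') hx) hxM)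
      (fun x y₁ y₂ x' y' h₁ h₂ h' hx hx' hy =>
        hsecond x y₁ y₂ x' y' h₁ h₂ h' hy (lt_of_lt_of_le (not_le.1 hx') hx))
    refine fun Q => ⟨fun hQ => ?_, by rintro rfl; exact ⟨rfl, hsh⟩⟩
    have := hfin Q hQ.fst_eq
    exact SupermartingaleTransport.eq_of_restrict_prod_snd_eq (fun _ => measurableSet_Ici)
      (fun ρ σ _ _ h => Measure.ext_of_Ici ρ σ h) fun x => (hQ.shadow x).eq (hsh x)
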